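/- Let $H=(V,E)$ be a directed hypergraph on a finite vertex set $V$ with $|V|=n\ge 2$: each edge $e\in E$ is a subset of $V$ partitioned into a nonempty tail $T_e$ and a nonempty head $H_e$, and distinct edges have distinct vertex sets. Suppose that $H$ is $m$-uniform ($m\ge 1$), i.e. $|e|=|T_e|+|H_e|=m$ for every $e\in E$. The out-degree of $v\in V$ is $d_v^+=|\{e\in E: v\in T_e\}|$; let $\delta^+$ and $\Delta^+$ be the smallest and the highest out-degree, and let $v_1,\dots,v_n$ be an enumeration of $V$ whose out-degrees $d_i^+=d_{v_i}^+$ satisfy $$\delta^+=d_1^+\le d_2^+\le\dots\le d_{n-1}^+\le d_n^+=\Delta^+ .$$ The out-adjacency hypermatrix $A_H^+=(a^+_{i_1\dots i_m})$ of order $m$ and dimension $n$ has the entry $$a^+_{i_1\dots i_m}=\frac{1}{(m-k)!\,(k-1)!}$$ if there is an edge $e$ with $|T_e|=k$ such that $i_1,\dots,i_m$ are distinct, $T_e=\{v_{i_1},\dots,v_{i_k}\}$ and $H_e=\{v_{i_{k+1}},\dots,v_{i_m}\}$, and all its other entries are $0$. A number $\lambda\in\mathbb{C}$ is an eigenvalue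 of a real hypermatrix $A=(a_{i_1\dots i_m})$ if there is $x\in\mathbb{C}^n\setminus\{0\}$ with $$\sum_{i_2,\dots,i_m=1}^n a_{i i_2\dots i_m}x_{i_2}\cdots x_{i_m}=\lambda x_i^{m-1}\qquad (i=1,\dots,n),$$ and $\rho(A)$ denotes the largest modulus of an eigenvalue of $A$. Then the maximum defining $\rho(A_H^+)$ exists, and $$(\delta^+)^{\frac1m}\,(d_2^+)^{1-\frac1m}\;\le\;\rho(A_H^+)\;\le\;(\Delta^+)^{\frac1m}\,(d_{n-1}^+)^{1-\frac1m}.$$ -/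

import Mathlib

/-- A directed hypergraph on the vertex set `V`. A directed hyperedge is a nonempty set of vertices
partitioned into a nonempty tail and a nonempty head; it is stored as the pair `(tail, head)`.
Distinct edges have distinct underlying vertex sets `tail ∪ head`. -/
structure DirectedHypergraph (V : Type*) [DecidableEq V] where
  /-- the edges, as pairs (tail, head) -/
  edges : Finset (Finset V × Finset V)
  tail_nonempty : ∀ e ∈ edges, e.1.Nonempty
  head_nonempty : ∀ e ∈ edges, e.2.Nonempty
  disjoint : ∀ e ∈ edges, Disjoint e.1 e.2
  union_inj : ∀ e ∈ edges, ∀ f ∈ edges, e.1 ∪ e.2 = f.1 ∪ f.2 → e = f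

/-- A real hypermatrix of order `m` whose indices range over `V`. -/
abbrev Hypermatrix (m : ℕ) (V : Type*) := (Fin m → V) → ℝ

namespace Hypermatrix

variable {m : ℕ} [NeZero m] {V : Type*} [Fintype V] [DecidableEq V]

/-- `(A x^{m-1})_i = ∑_{i₂, …, i_m} a_{i i₂ … i_m} x_{i₂} ⋯ x_{i_m}`: the sum over all multi-indices
`I` whose first entry `I 0` is `i`. -/
noncomputable def apply (A : Hypermatrix m V) (x : V → ℂ) (i : V) : ℂ :=
  ∑ I : Fin m → V with I 0 = i, (A I : ℂ) * ∏ j ∈ Finset.univ.erase (0 : Fin m), x (I j)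

/-- `l` is an eigenvalue of `A`: `A x^{m-1} = l x^{[m-1]}` for some nonzero complex vector `x`. -/
def IsEigenvalue (A : Hypermatrix m V) (l : ℂ) : Prop :=
  ∃ x : V → ℂ, x ≠ 0 ∧ ∀ i, A.apply x i = l * x i ^ (m - 1)

/-- The set of the moduli of the eigenvalues of `A`. -/
def eigenvalueModuli (A : Hypermatrix m V) : Set ℝ :=
  {r | ∃ l : ℂ, A.IsEigenvalue l ∧ r = ‖l‖}

/-- The spectral radius: the largest modulus of an eigenvalue. -/
noncomputable def spectralRadius (A : Hypermatrix m V) : ℝ :=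
  sSup A.eigenvalueModuli

end Hypermatrix

namespace DirectedHypergraph

variable {V : Type*} [DecidableEq V] (H : DirectedHypergraph V)

/-- `H` is `m`-uniform: every edge has exactly `m` vertices. -/
def IsUniform (m : ℕ) : Prop :=
  ∀ e ∈ H.edges, (e.1 ∪ e.2).card = m

/-- The out-degree of `v`: the number of edges whose tail contains `v`. -/
def outDegree (v : V) : ℕ :=
  (H.edges.filter fun e => v ∈ e.1).card

/-- The smallest out-degree. -/
noncomputable def minOutDegree : ℕ := ⨅ v, H.outDegree v

/-- The highest out-degree (used for finite `V` only). -/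
noncomputable def maxOutDegree : ℕ := ⨆ v, H.outDegree v

/-- The multi-index `I = (i₁, …, i_m)` lists the edge `e`: its entries are distinct, the first
`k = |T_e|` of them are exactly the vertices of the tail, and the remaining ones are exactly the
vertices of the head. -/
def ListsEdge {m : ℕ} (I : Fin m → V) (e : Finset V × Finset V) : Prop :=
  Function.Injective I ∧
    (Finset.univ.filter fun j : Fin m => (j : ℕ) < e.1.card).image I = e.1 ∧
    (Finset.univ.filter fun j : Fin m => e.1.card ≤ (j : ℕ)).image I = e.2

open Classical in
/-- The out-adjacency hypermatrix of an `m`-uniform directed hypergraph: the entry at `I` is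
`1 / ((m - k)! (k - 1)!)` if `I` lists an edge with tail length `k`, and `0` if it lists no edge.
(A multi-index lists at most one edge, so the sum has at most one nonzero term.) -/
noncomputable def outAdjacency (m : ℕ) : Hypermatrix m V := fun I =>
  ∑ e ∈ H.edges, if ListsEdge I e then
    1 / (((m - e.1.card).factorial : ℝ) * ((e.1.card - 1).factorial : ℝ)) else 0

end DirectedHypergraph

/-! For a nonnegative hypermatrix the largest eigenvalue modulus is the Collatz–Wielandt maximum
`r`: it is attained at a nonnegative eigenvector, and `μ y^(m-1) ≤ A y` with `y ≥ 0`, `y ≠ 0` forces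
`μ ≤ r`, while `A w ≤ μ w^(m-1)` with `w > 0` forces `r ≤ μ` (`exists_perron`,
`eigenvalue_le_of_realApply_le`).

For the out-adjacency hypermatrix, `(A w) i` is the sum over the edges with `i` in the tail of the
product of `w` over the other vertices (`realApply_outAdjacency`). Test it on the vector equal to
`t` at one vertex `a` of extreme degree `d` and to `1` elsewhere. At `a` the action is exactly `d`;
elsewhere each edge contributes `1` or `t`. With `D` the next extreme degree, `t = (d / D)^(1/m)`
makes both constraints give the same number `d^(1/m) D^(1-1/m)`. -/

/-! ### Nonlinear Perron–Frobenius theory on the nonnegative cone -/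

open Filter Topology in
/-- A continuous, strictly monotone and `p`-homogeneous self-map of the nonnegative cone has a
nonnegative eigenvector, whose eigenvalue is the Collatz–Wielandt maximum. -/
theorem exists_eigenvector_of_strictMono {V : Type*} [Fintype V] [Nonempty V] {p : ℕ} (hp : p ≠ 0)
    (f : (V → ℝ) → V → ℝ) (hc : Continuous f)
    (hf : ∀ c : ℝ, ∀ x, f (c • x) = c ^ p • f x)
    (hs : ∀ x y, 0 ≤ x → x ≤ y → x ≠ y → ∀ i, f x i < f y i) :
    ∃ r : ℝ, 0 ≤ r ∧ ∃ x ∈ stdSimplex ℝ V, (∀ i, f x i = r * x i ^ p) ∧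
      ∀ y : V → ℝ, 0 ≤ y → y ≠ 0 → ∀ μ : ℝ, (∀ i, μ * y i ^ p ≤ f y i) → μ ≤ r := by
  classical
  have hf0 : f 0 = 0 := by
    have := hf 0 0
    simpa [hp] using this
  have hmono : ∀ x y, 0 ≤ x → x ≤ y → ∀ i, f x i ≤ f y i := by
    intro x y hx hxy i
    by_cases h : x = y
    · rw [h]
    · exact (hs x y hx hxy h i).le
  have hnn : ∀ x, 0 ≤ x → ∀ i, 0 ≤ f x i := by
    intro x hx i
    simpa [hf0] using hmono 0 x le_rfl hx i
  set N : ℝ := (Fintype.card V : ℝ) with hN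
  have hNpos : 0 < N := by rw [hN]; exact_mod_cast Fintype.card_pos
  set M : ℝ := (∑ i, f 1 i) * N ^ p with hM
  -- A point of the simplex has a coordinate at least `1 / N`; the inequality at that coordinate
  -- bounds `μ`.
  have hbound : ∀ x ∈ stdSimplex ℝ V, ∀ μ : ℝ, 0 ≤ μ → (∀ i, μ * x i ^ p ≤ f x i) → μ ≤ M := by
    intro x hx μ hμ0 hμ
    obtain ⟨i, -, hi⟩ : ∃ i ∈ (Finset.univ : Finset V), 1 / N ≤ x i := by
      apply Finset.exists_le_of_sum_le Finset.univ_nonempty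
      rw [hx.2]
      simp [← hN, hNpos.ne']
    have h1 : f x i ≤ ∑ i, f 1 i := by
      refine le_trans (hmono x 1 hx.1 ?_ i) ?_
      · intro j
        rw [Pi.one_apply, ← hx.2]
        exact Finset.single_le_sum (fun k _ => hx.1 k) (Finset.mem_univ j)
      · exact Finset.single_le_sum (f := fun i => f 1 i)
          (fun k _ => hnn 1 zero_le_one k) (Finset.mem_univ i)
    have h2 : 1 ≤ (N * x i) ^ p := by
      apply one_le_pow₀
      rw [div_le_iff₀ hNpos] at hi
      linarith
    calc μ ≤ μ * (N * x i) ^ p := le_mul_of_one_le_right hμ0 h2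
      _ = (μ * x i ^ p) * N ^ p := by ring
      _ ≤ M := by
        rw [hM]
        gcongr
        exact (hμ i).trans h1
  set S : Set (ℝ × (V → ℝ)) :=
    (Set.Icc 0 M ×ˢ stdSimplex ℝ V) ∩ {q | ∀ i, q.1 * q.2 i ^ p ≤ f q.2 i} with hS
  have hScompact : IsCompact S := by
    apply (isCompact_Icc.prod (isCompact_stdSimplex ℝ V)).inter_right
    rw [Set.ofPred_forall]
    refine isClosed_iInter fun i => isClosed_le (by fun_prop) ?_
    exact (continuous_apply i).comp (hc.comp continuous_snd)
  have hM0 : 0 ≤ M :=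
    mul_nonneg (Finset.sum_nonneg fun i _ => hnn 1 zero_le_one i) (by positivity)
  have hSne : S.Nonempty := by
    refine ⟨(0, Pi.single (Classical.arbitrary V) 1), ⟨⟨⟨le_rfl, hM0⟩, single_mem_stdSimplex ℝ _⟩, ?_⟩⟩
    intro i
    rw [zero_mul]
    exact hnn _ (single_mem_stdSimplex ℝ _).1 i
  obtain ⟨⟨r, x⟩, hrx, hmax⟩ := hScompact.exists_isMaxOn hSne continuous_fst.continuousOn
  have hr0 : 0 ≤ r := hrx.1.1.1
  have hx : x ∈ stdSimplex ℝ V := hrx.1.2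
  have hrxi : ∀ i, r * x i ^ p ≤ f x i := hrx.2
  have hopt : ∀ y : V → ℝ, 0 ≤ y → y ≠ 0 → ∀ μ : ℝ, (∀ i, μ * y i ^ p ≤ f y i) → μ ≤ r := by
    intro y hy hy0 μ hμ
    rcases lt_or_ge μ 0 with h | h
    · linarith
    have hsum : 0 < ∑ i, y i := by
      obtain ⟨i, hi⟩ := Function.ne_iff.1 hy0
      exact Finset.sum_pos' (fun i _ => hy i) ⟨i, Finset.mem_univ i, lt_of_le_of_ne (hy i) (Ne.symm hi)⟩
    set c : ℝ := (∑ i, y i)⁻¹ with hcdef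
    have hcpos : 0 < c := inv_pos.2 hsum
    have hz : c • y ∈ stdSimplex ℝ V := by
      refine ⟨fun i => mul_nonneg hcpos.le (hy i), ?_⟩
      simp only [Pi.smul_apply, smul_eq_mul]
      rw [← Finset.mul_sum, hcdef, inv_mul_cancel₀ hsum.ne']
    have hzμ : ∀ i, μ * (c • y) i ^ p ≤ f (c • y) i := by
      intro i
      rw [hf, Pi.smul_apply, Pi.smul_apply, smul_eq_mul, smul_eq_mul]
      calc μ * (c * y i) ^ p = c ^ p * (μ * y i ^ p) := by ring
        _ ≤ c ^ p * f y i := by gcongr; exact hμ i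
    exact hmax (show (μ, c • y) ∈ S from ⟨⟨⟨h, hbound _ hz μ h hzμ⟩, hz⟩, hzμ⟩)
  refine ⟨r, hr0, x, hx, ?_, hopt⟩
  -- If equality fails somewhere, `z = f(x)^(1/p)` dominates `r^(1/p) x` and differs from it. Strict
  -- monotonicity then gives `r z^p < f z` in every coordinate, leaving room to increase `r`.
  by_contra hne
  set c : ℝ := r ^ (1 / (p : ℝ)) with hcdef
  have hroot : ∀ a : ℝ, 0 ≤ a → (a ^ (1 / (p : ℝ))) ^ p = a := fun a ha => by
    rw [one_div, Real.rpow_inv_natCast_pow ha hp]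
  have hc0 : 0 ≤ c := Real.rpow_nonneg hr0 _
  set z : V → ℝ := fun i => f x i ^ (1 / (p : ℝ)) with hzdef
  have hz0 : 0 ≤ z := fun i => Real.rpow_nonneg (hnn x hx.1 i) _
  have hzp : ∀ i, z i ^ p = f x i := fun i => hroot _ (hnn x hx.1 i)
  have hcx : c • x ≤ z := by
    intro i
    refine le_of_pow_le_pow_left₀ hp (hz0 i) ?_
    rw [hzp, Pi.smul_apply, smul_eq_mul, mul_pow, hroot r hr0]
    exact hrxi i
  have hcne : c • x ≠ z := by
    intro h
    apply hne
    intro i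
    rw [← hzp, ← h, Pi.smul_apply, smul_eq_mul, mul_pow, hroot r hr0]
  have hcx0 : 0 ≤ c • x := fun i => mul_nonneg hc0 (hx.1 i)
  have hlt : ∀ i, r * z i ^ p < f z i := by
    intro i
    have := hs _ _ hcx0 hcx hcne i
    rwa [hf, Pi.smul_apply, smul_eq_mul, hroot r hr0, ← hzp] at this
  have hzne : z ≠ 0 := by
    intro h
    exact hcne (le_antisymm hcx (h ▸ hcx0))
  have hev : ∀ᶠ μ in 𝓝[>] r, ∀ i, μ * z i ^ p ≤ f z i := by
    rw [eventually_all]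
    intro i
    have : Tendsto (fun μ : ℝ => μ * z i ^ p) (𝓝[>] r) (𝓝 (r * z i ^ p)) :=
      (Continuous.tendsto (by fun_prop) r).mono_left nhdsWithin_le_nhds
    exact (this.eventually (gt_mem_nhds (hlt i))).mono fun _ h => le_of_lt h
  obtain ⟨μ, hμ, hμr⟩ := (hev.and self_mem_nhdsWithin).exists
  exact absurd (hopt z hz0 hzne μ hμ) (not_le.2 hμr)

open Filter Topology in
/-- A continuous, monotone and `p`-homogeneous self-map of the nonnegative cone has a
nonnegative eigenvector, whose eigenvalue is the Collatz–Wielandt maximum. -/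
theorem exists_eigenvector_of_mono {V : Type*} [Fintype V] [Nonempty V] {p : ℕ} (hp : p ≠ 0)
    (f : (V → ℝ) → V → ℝ) (hc : Continuous f)
    (hf : ∀ c : ℝ, ∀ x, f (c • x) = c ^ p • f x)
    (hs : ∀ x y, 0 ≤ x → x ≤ y → ∀ i, f x i ≤ f y i) :
    ∃ r : ℝ, 0 ≤ r ∧ ∃ x ∈ stdSimplex ℝ V, (∀ i, f x i = r * x i ^ p) ∧
      ∀ y : V → ℝ, 0 ≤ y → y ≠ 0 → ∀ μ : ℝ, (∀ i, μ * y i ^ p ≤ f y i) → μ ≤ r := by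
  -- The perturbation is `p`-homogeneous and strictly increasing, so the strict case applies; it
  -- vanishes as `k → ∞`.
  have key : ∀ k : ℕ, ∃ r : ℝ, 0 ≤ r ∧ ∃ x ∈ stdSimplex ℝ V,
      (∀ i, f x i + 1 / ((k : ℝ) + 1) * (∑ j, x j) ^ p = r * x i ^ p) ∧
      ∀ y : V → ℝ, 0 ≤ y → y ≠ 0 → ∀ μ : ℝ,
        (∀ i, μ * y i ^ p ≤ f y i + 1 / ((k : ℝ) + 1) * (∑ j, y j) ^ p) → μ ≤ r := by
    intro k
    refine exists_eigenvector_of_strictMono hp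
      (fun x i => f x i + 1 / ((k : ℝ) + 1) * (∑ j, x j) ^ p) ?_ ?_ ?_
    · refine continuous_pi fun i => ?_
      have := (continuous_apply i).comp hc
      exact this.add (by fun_prop)
    · intro c x
      ext i
      simp only [hf, Pi.smul_apply, smul_eq_mul, ← Finset.mul_sum]
      ring
    · intro x y hx hxy hne i
      have hsum : ∑ j, x j < ∑ j, y j := by
        obtain ⟨j, hj⟩ := Function.ne_iff.1 hne
        exact Finset.sum_lt_sum (fun j _ => hxy j)
          ⟨j, Finset.mem_univ j, lt_of_le_of_ne (hxy j) hj⟩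
      have hx0 : 0 ≤ ∑ j, x j := Finset.sum_nonneg fun j _ => hx j
      have := pow_lt_pow_left₀ hsum hx0 hp
      have h1 := hs x y hx hxy i
      have hk : (0 : ℝ) < 1 / ((k : ℝ) + 1) := by positivity
      have := mul_lt_mul_of_pos_left this hk
      linarith
  choose r hr0 x hx hrx hopt using key
  have hxne : ∀ k, x k ≠ 0 := by
    intro k h
    have := (hx k).2
    simp [h] at this
  -- The perturbation decreases in `k`, so the `k`-th eigenvector is admissible for the problem `k =
  -- 0`. This confines all eigenvalues to a compact interval.
  have hle : ∀ k, r k ≤ r 0 := by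
    intro k
    refine hopt 0 (x k) (hx k).1 (hxne k) _ fun i => ?_
    rw [← hrx k i]
    have h1 : 1 / ((k : ℝ) + 1) ≤ 1 / (((0 : ℕ) : ℝ) + 1) :=
      one_div_le_one_div_of_le (by norm_num) (by simp)
    rw [(hx k).2]
    gcongr
  obtain ⟨⟨r', x'⟩, hmem, φ, hφ, hlim⟩ :=
    ((isCompact_Icc (a := (0 : ℝ)) (b := r 0)).prod (isCompact_stdSimplex ℝ V)).tendsto_subseq
      (x := fun k => (r k, x k)) fun k => ⟨⟨hr0 k, hle k⟩, hx k⟩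
  have hlr : Tendsto (fun k => r (φ k)) atTop (𝓝 r') := (continuous_fst.tendsto _).comp hlim
  have hlx : Tendsto (fun k => x (φ k)) atTop (𝓝 x') := (continuous_snd.tendsto _).comp hlim
  refine ⟨r', hmem.1.1, x', hmem.2, fun i => ?_, fun y hy hy0 μ hμ => ?_⟩
  · have h1 : Tendsto (fun k => f (x (φ k)) i + 1 / ((φ k : ℝ) + 1)) atTop (𝓝 (f x' i + 0)) := by
      refine Tendsto.add ?_ (tendsto_one_div_add_atTop_nhds_zero_nat.comp hφ.tendsto_atTop)
      exact (((continuous_apply i).comp hc).tendsto x').comp hlx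
    have h2 : Tendsto (fun k => r (φ k) * x (φ k) i ^ p) atTop (𝓝 (r' * x' i ^ p)) :=
      hlr.mul ((((continuous_apply i).tendsto x').comp hlx).pow p)
    rw [add_zero] at h1
    refine tendsto_nhds_unique (h1.congr fun k => ?_) h2
    rw [← hrx, (hx _).2, one_pow, mul_one]
  · refine ge_of_tendsto' hlr fun k => hopt _ y hy hy0 μ fun i => (hμ i).trans ?_
    have : 0 ≤ ∑ j, y j := Finset.sum_nonneg fun j _ => hy j
    have : 0 ≤ 1 / ((φ k : ℝ) + 1) * (∑ j, y j) ^ p := by positivity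
    linarith

/-! ### Spectral radius of a nonnegative hypermatrix -/

namespace Hypermatrix

variable {m : ℕ} [NeZero m] {V : Type*} [Fintype V] [DecidableEq V]

/-- The action `A x^{m-1}` on real vectors. -/
noncomputable def realApply (A : Hypermatrix m V) (x : V → ℝ) (i : V) : ℝ :=
  ∑ I : Fin m → V with I 0 = i, A I * ∏ j ∈ Finset.univ.erase (0 : Fin m), x (I j)

theorem apply_ofReal (A : Hypermatrix m V) (x : V → ℝ) (i : V) :
    A.apply (fun v => (x v : ℂ)) i = (A.realApply x i : ℂ) := by
  simp [apply, realApply]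

theorem continuous_realApply (A : Hypermatrix m V) : Continuous A.realApply := by
  refine continuous_pi fun i => ?_
  unfold realApply
  fun_prop

theorem realApply_smul (A : Hypermatrix m V) (c : ℝ) (x : V → ℝ) :
    A.realApply (c • x) = c ^ (m - 1) • A.realApply x := by
  ext i
  simp only [realApply, Pi.smul_apply, smul_eq_mul, Finset.mul_sum, Finset.prod_mul_distrib,
    Finset.prod_const, Finset.card_erase_of_mem (Finset.mem_univ _), Finset.card_univ,
    Fintype.card_fin]
  exact Finset.sum_congr rfl fun I _ => by ring

theorem realApply_mono {A : Hypermatrix m V} (hA : ∀ I, 0 ≤ A I) {x y : V → ℝ} (hx : 0 ≤ x)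
    (hxy : x ≤ y) (i : V) : A.realApply x i ≤ A.realApply y i := by
  unfold realApply
  gcongr with I _ j _
  · exact hA I
  · exact fun j _ => hx _
  · exact hxy _

theorem norm_apply_le {A : Hypermatrix m V} (hA : ∀ I, 0 ≤ A I) (x : V → ℂ) (i : V) :
    ‖A.apply x i‖ ≤ A.realApply (fun v => ‖x v‖) i := by
  refine (norm_sum_le _ _).trans (Finset.sum_le_sum fun I _ => ?_)
  rw [norm_mul, norm_prod, Complex.norm_real, Real.norm_of_nonneg (hA I)]

/-- The weak Perron–Frobenius theorem for nonnegative hypermatrices: the largest modulus of an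
eigenvalue exists, it is an eigenvalue with a nonnegative eigenvector, and it is the
Collatz–Wielandt maximum. -/
theorem exists_perron [Nonempty V] (hm : 2 ≤ m) {A : Hypermatrix m V} (hA : ∀ I, 0 ≤ A I) :
    ∃ r : ℝ, IsGreatest A.eigenvalueModuli r ∧
      (∃ x : V → ℝ, 0 ≤ x ∧ x ≠ 0 ∧ ∀ i, A.realApply x i = r * x i ^ (m - 1)) ∧
      ∀ y : V → ℝ, 0 ≤ y → y ≠ 0 → ∀ μ : ℝ,
        (∀ i, μ * y i ^ (m - 1) ≤ A.realApply y i) → μ ≤ r := by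
  obtain ⟨r, hr, x, hx, hrx, hopt⟩ := exists_eigenvector_of_mono (p := m - 1) (by omega)
    A.realApply A.continuous_realApply A.realApply_smul (fun x y hx hxy => realApply_mono hA hx hxy)
  have hx0 : x ≠ 0 := by
    intro h
    have := hx.2
    simp [h] at this
  refine ⟨r, ⟨⟨r, ⟨fun v => (x v : ℂ), ?_, fun i => ?_⟩, ?_⟩, ?_⟩, ⟨x, hx.1, hx0, hrx⟩, hopt⟩
  · intro h
    apply hx0
    ext i
    simpa using congrFun h i
  · rw [apply_ofReal, hrx]
    push_cast
    rfl
  · rw [Complex.norm_real, Real.norm_of_nonneg hr]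
  -- By the triangle inequality the moduli of a complex eigenvector form an admissible vector for `μ
  -- = ‖l‖`.
  · rintro _ ⟨l, ⟨y, hy0, hy⟩, rfl⟩
    refine hopt (fun v => ‖y v‖) (fun v => norm_nonneg _) ?_ _ fun i => ?_
    · intro h
      apply hy0
      ext i
      simpa using congrFun h i
    · refine le_trans (le_of_eq ?_) (norm_apply_le hA y i)
      rw [hy, norm_mul, norm_pow]

/-- Collatz–Wielandt upper bound. -/
theorem eigenvalue_le_of_realApply_le {A : Hypermatrix m V} (hA : ∀ I, 0 ≤ A I) {x w : V → ℝ}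
    (hx : 0 ≤ x) (hx0 : x ≠ 0) (hw : ∀ i, 0 < w i) {r μ : ℝ}
    (hr : ∀ i, A.realApply x i = r * x i ^ (m - 1))
    (hμ : ∀ i, A.realApply w i ≤ μ * w i ^ (m - 1)) : r ≤ μ := by
  obtain ⟨j, hj⟩ := Function.ne_iff.1 hx0
  have hjpos : 0 < x j := lt_of_le_of_ne (hx j) (Ne.symm hj)
  -- Scale `w` to the smallest multiple above `x`; the two touch at `i`, where the two inequalities
  -- can be compared.
  obtain ⟨i, -, hi⟩ := Finset.exists_max_image Finset.univ (fun i => x i / w i)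
    ⟨j, Finset.mem_univ j⟩
  set s : ℝ := x i / w i with hs
  have hspos : 0 < s := (div_pos hjpos (hw j)).trans_le (hi j (Finset.mem_univ j))
  have hxi : x i = s * w i := by rw [hs, div_mul_cancel₀ _ (hw i).ne']
  have hxs : x ≤ s • w := fun k => by
    rw [Pi.smul_apply, smul_eq_mul, ← div_le_iff₀ (hw k)]
    exact hi k (Finset.mem_univ k)
  have hpos : 0 < x i ^ (m - 1) := by
    rw [hxi]
    have := hw i
    positivity
  refine le_of_mul_le_mul_right ?_ hpos
  calc r * x i ^ (m - 1) = A.realApply x i := (hr i).symm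
    _ ≤ A.realApply (s • w) i := realApply_mono hA hx hxs i
    _ = s ^ (m - 1) * A.realApply w i := by rw [realApply_smul, Pi.smul_apply, smul_eq_mul]
    _ ≤ s ^ (m - 1) * (μ * w i ^ (m - 1)) := by gcongr; exact hμ i
    _ = μ * x i ^ (m - 1) := by rw [hxi]; ring

end Hypermatrix

/-! ### Counting the multi-indices that list an edge -/

namespace DirectedHypergraph

variable {V : Type*} [DecidableEq V]

/-- The block of a vertex, relative to a root `i` in the tail `T`: root, rest of the tail, head. -/
def vertexBlock (i : V) (T : Finset V) (v : V) : Fin 3 :=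
  if v = i then 0 else if v ∈ T then 1 else 2

/-- The block of a position in a multi-index whose first `k` entries list the tail. -/
def positionBlock {m : ℕ} [NeZero m] (k : ℕ) (j : Fin m) : Fin 3 :=
  if j = 0 then 0 else if (j : ℕ) < k then 1 else 2

theorem card_filter_val_lt {m k : ℕ} (h : k ≤ m) :
    (Finset.univ.filter fun j : Fin m => (j : ℕ) < k).card = k := by
  rw [Fin.card_filter_val_lt, min_eq_right h]

theorem card_filter_le_val {m k : ℕ} (h : k ≤ m) :
    (Finset.univ.filter fun j : Fin m => k ≤ (j : ℕ)).card = m - k := by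
  have := Finset.card_filter_add_card_filter_not (s := (Finset.univ : Finset (Fin m)))
    (fun j => (j : ℕ) < k)
  rw [card_filter_val_lt h, Finset.card_univ, Fintype.card_fin] at this
  simp only [not_lt] at this
  omega

/-- Turns listings with a prescribed first entry into block-preserving injections, which the
stabilizer of a colouring can count. -/
theorem listsEdge_and_iff {m : ℕ} [NeZero m] {I : Fin m → V} {e : Finset V × Finset V}
    (hd : Disjoint e.1 e.2) (hc : (e.1 ∪ e.2).card = m) {i : V} (hi : i ∈ e.1) :
    ListsEdge I e ∧ I 0 = i ↔ Function.Injective I ∧ (∀ j, I j ∈ e.1 ∪ e.2) ∧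
      ∀ j, vertexBlock i e.1 (I j) = positionBlock e.1.card j := by
  have hk : 0 < e.1.card := Finset.card_pos.2 ⟨i, hi⟩
  rw [Finset.card_union_of_disjoint hd] at hc
  constructor
  · rintro ⟨⟨hinj, h1, h2⟩, h0⟩
    have m1 : ∀ j : Fin m, (j : ℕ) < e.1.card → I j ∈ e.1 := fun j hj => by
      rw [← h1]
      exact Finset.mem_image_of_mem _ (by simpa using hj)
    have m2 : ∀ j : Fin m, ¬ (j : ℕ) < e.1.card → I j ∈ e.2 := fun j hj => by
      rw [← h2]
      exact Finset.mem_image_of_mem _ (by simpa using hj)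
    refine ⟨hinj, fun j => ?_, fun j => ?_⟩
    · by_cases hj : (j : ℕ) < e.1.card
      · exact Finset.mem_union_left _ (m1 j hj)
      · exact Finset.mem_union_right _ (m2 j hj)
    · unfold vertexBlock positionBlock
      have : I j = i ↔ j = 0 := by rw [← h0]; exact hinj.eq_iff
      simp only [this]
      split_ifs with h h' h'' h''
      · rfl
      · rfl
      · exact absurd h' (Finset.disjoint_right.1 hd (m2 j h''))
      · exact absurd (m1 j h'') h'
      · rfl
  · rintro ⟨hinj, hmem, hb⟩
    have h0 : I 0 = i := by
      have := hb 0
      unfold vertexBlock positionBlock at this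
      by_contra h
      simp only [h, if_true, if_false] at this
      split_ifs at this <;> simp at this
    have hT : ∀ j : Fin m, (j : ℕ) < e.1.card ↔ I j ∈ e.1 := fun j => by
      by_cases hj : j = 0
      · subst hj
        simp [h0, hi, hk]
      · have hne : I j ≠ i := by rw [← h0]; exact hinj.ne hj
        have := hb j
        unfold vertexBlock positionBlock at this
        simp only [hj, hne, if_false] at this
        split_ifs at this <;> simp_all
    have hle : e.1.card ≤ m := by omega
    refine ⟨⟨hinj, Finset.eq_of_subset_of_card_le ?_ ?_, Finset.eq_of_subset_of_card_le ?_ ?_⟩, h0⟩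
    · intro v hv
      obtain ⟨j, hj, rfl⟩ := Finset.mem_image.1 hv
      exact (hT j).1 (Finset.mem_filter.1 hj).2
    · rw [Finset.card_image_of_injective _ hinj, card_filter_val_lt hle]
    · intro v hv
      obtain ⟨j, hj, rfl⟩ := Finset.mem_image.1 hv
      have := (hT j).not.1 (not_lt.2 (Finset.mem_filter.1 hj).2)
      exact (Finset.mem_union.1 (hmem j)).resolve_left this
    · rw [Finset.card_image_of_injective _ hinj, card_filter_le_val hle]
      omega

theorem card_positionBlock {m : ℕ} [NeZero m] {k : ℕ} (hk : 0 < k) (hkm : k ≤ m) (d : Fin 3) :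
    Fintype.card {j : Fin m // positionBlock k j = d} = ![1, k - 1, m - k] d := by
  fin_cases d
  · rw [Fintype.card_of_subtype {0}]
    · simp
    · intro j
      unfold positionBlock
      split_ifs <;> simp_all
  · rw [Fintype.card_of_subtype ((Finset.univ.filter fun j : Fin m => (j : ℕ) < k).erase 0)]
    · rw [Finset.card_erase_of_mem (by simpa using hk), card_filter_val_lt hkm]
      simp
    · intro j
      unfold positionBlock
      split_ifs <;> simp_all
  · have := hk.ne'
    rw [Fintype.card_of_subtype (Finset.univ.filter fun j : Fin m => k ≤ (j : ℕ))]
    · rw [card_filter_le_val hkm]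
      simp
    · intro j
      unfold positionBlock
      split_ifs <;> simp_all

theorem card_vertexBlock {e : Finset V × Finset V} (hd : Disjoint e.1 e.2) {i : V} (hi : i ∈ e.1)
    (d : Fin 3) :
    Fintype.card {v : ↥(e.1 ∪ e.2) // vertexBlock i e.1 v = d} =
      ![1, e.1.card - 1, e.2.card] d := by
  have hi2 : i ∉ e.2 := Finset.disjoint_left.1 hd hi
  have hd' : ∀ v ∈ e.2, v ∉ e.1 := fun v hv => Finset.disjoint_right.1 hd hv
  have key : Fintype.card {v : ↥(e.1 ∪ e.2) // vertexBlock i e.1 v = d} =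
      ((e.1 ∪ e.2).filter fun v => vertexBlock i e.1 v = d).card := by
    rw [← Fintype.card_coe]
    exact Fintype.card_congr ((Equiv.subtypeSubtypeEquivSubtypeInter (fun v => v ∈ e.1 ∪ e.2)
      (fun v => vertexBlock i e.1 v = d)).trans (Equiv.subtypeEquivRight fun v => by simp))
  rw [key]
  fin_cases d
  · rw [show ((e.1 ∪ e.2).filter fun v => vertexBlock i e.1 v = _) = {i} from ?_]
    · simp
    · ext v
      unfold vertexBlock
      simp only [Finset.mem_filter, Finset.mem_union, Finset.mem_singleton]
      split_ifs <;> simp_all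
  · rw [show ((e.1 ∪ e.2).filter fun v => vertexBlock i e.1 v = _) = e.1.erase i from ?_]
    · simp [hi]
    · ext v
      unfold vertexBlock
      simp only [Finset.mem_filter, Finset.mem_union, Finset.mem_erase]
      split_ifs <;> simp_all
  · rw [show ((e.1 ∪ e.2).filter fun v => vertexBlock i e.1 v = _) = e.2 from ?_]
    · simp
    · ext v
      unfold vertexBlock
      simp only [Finset.mem_filter, Finset.mem_union]
      split_ifs
      · simp_all
      · have := hd' v
        simp_all
        tauto
      · simp_all

open Classical in
/-- The number of multi-indices that list `e` and start at a given tail vertex. -/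
theorem card_listsEdge {m : ℕ} [NeZero m] [Fintype V] {e : Finset V × Finset V}
    (hd : Disjoint e.1 e.2) (hc : (e.1 ∪ e.2).card = m) {i : V} (hi : i ∈ e.1) :
    (Finset.univ.filter fun I : Fin m → V => ListsEdge I e ∧ I 0 = i).card =
      (m - e.1.card).factorial * (e.1.card - 1).factorial := by
  have hk : 0 < e.1.card := Finset.card_pos.2 ⟨i, hi⟩
  have hc' := hc
  rw [Finset.card_union_of_disjoint hd] at hc'
  have hkm : e.1.card ≤ m := by omega
  have hk2 : e.2.card = m - e.1.card := by omega
  have hfib : ∀ d, Nonempty ({j : Fin m // positionBlock e.1.card j = d} ≃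
      {v : ↥(e.1 ∪ e.2) // vertexBlock i e.1 v = d}) := fun d => by
    rw [← Fintype.card_eq, card_positionBlock hk hkm, card_vertexBlock hd hi, hk2]
  -- Fix one block-preserving bijection. Every other listing is `E ∘ g` for a unique permutation `g`
  -- of positions preserving the blocks, whose sizes are `1`, `k - 1`, `m - k`.
  let E : Fin m ≃ ↥(e.1 ∪ e.2) := Equiv.ofFiberEquiv fun d => (hfib d).some
  have hE : ∀ j, vertexBlock i e.1 (E j) = positionBlock e.1.card j :=
    fun j => Equiv.ofFiberEquiv_map (fun d => (hfib d).some) j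
  have hstab := DomMulAct.stabilizer_card (positionBlock (m := m) e.1.card)
  rw [Fin.prod_univ_three, card_positionBlock hk hkm, card_positionBlock hk hkm,
    card_positionBlock hk hkm] at hstab
  simp only [Matrix.cons_val_zero, Matrix.cons_val_one, Matrix.cons_val,
    Nat.factorial_one, one_mul] at hstab
  rw [mul_comm, ← hstab, ← Fintype.card_coe]
  symm
  refine Fintype.card_of_bijective (f := fun g => ⟨fun j => (E (g.1 j) : V), ?_⟩) ⟨?_, ?_⟩
  · rw [Finset.mem_filter, listsEdge_and_iff hd hc hi]
    refine ⟨Finset.mem_univ _, fun a b h => ?_, fun j => (E _).2, fun j => ?_⟩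
    · exact g.1.injective (E.injective (Subtype.ext h))
    · rw [hE]
      exact congrFun g.2 j
  · intro g g' h
    ext j
    have := congrFun (Subtype.ext_iff.1 h) j
    exact congrArg _ (E.injective (Subtype.ext this))
  · rintro ⟨I, hI⟩
    rw [Finset.mem_filter, listsEdge_and_iff hd hc hi] at hI
    obtain ⟨-, hinj, hmem, hb⟩ := hI
    let F : Fin m → Fin m := fun j => E.symm ⟨I j, hmem j⟩
    have hF : Function.Injective F := fun a b h => by
      have := E.symm.injective h
      exact hinj (Subtype.ext_iff.1 this)
    refine ⟨⟨Equiv.ofBijective F (Finite.injective_iff_bijective.1 hF), ?_⟩, ?_⟩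
    · ext j
      simp only [Function.comp_apply, Equiv.ofBijective_apply]
      rw [← hE, ← hb]
      simp [F]
    · ext j
      simp [F]

/-! ### Action of the out-adjacency hypermatrix -/

variable (H : DirectedHypergraph V)

theorem outAdjacency_nonneg (m : ℕ) (I : Fin m → V) : 0 ≤ H.outAdjacency m I := by
  unfold outAdjacency
  refine Finset.sum_nonneg fun e _ => ?_
  split_ifs <;> positivity

theorem uniform_one_edges {H : DirectedHypergraph V} (hH : H.IsUniform 1) : H.edges = ∅ := by
  rw [Finset.eq_empty_iff_forall_notMem]
  intro e he
  have h := hH e he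
  rw [Finset.card_union_of_disjoint (H.disjoint e he)] at h
  have := Finset.card_pos.2 (H.tail_nonempty e he)
  have := Finset.card_pos.2 (H.head_nonempty e he)
  omega

variable [Fintype V]

/-- Each edge with `i` in its tail contributes the product over its other vertices. -/
theorem realApply_outAdjacency {m : ℕ} [NeZero m] (hH : H.IsUniform m) (w : V → ℝ) (i : V) :
    (H.outAdjacency m).realApply w i =
      ∑ e ∈ H.edges with i ∈ e.1, ∏ v ∈ (e.1 ∪ e.2).erase i, w v := by
  classical
  simp only [Hypermatrix.realApply, outAdjacency, Finset.sum_mul]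
  rw [Finset.sum_comm, Finset.sum_filter]
  refine Finset.sum_congr rfl fun e he => ?_
  have hd := H.disjoint e he
  have hc := hH e he
  have hlists : ∀ I : Fin m → V, ListsEdge I e → I 0 ∈ e.1 := fun I hI => by
    rw [← hI.2.1]
    exact Finset.mem_image_of_mem _ (by simpa using Finset.card_pos.2 (H.tail_nonempty e he))
  have hprod : ∀ I : Fin m → V, ListsEdge I e →
      ∏ j ∈ Finset.univ.erase (0 : Fin m), w (I j) = ∏ v ∈ (e.1 ∪ e.2).erase (I 0), w v := by
    intro I hI
    have himg : e.1 ∪ e.2 = Finset.univ.image I := by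
      symm
      refine Finset.eq_of_subset_of_card_le ?_ ?_
      · intro v hv
        obtain ⟨j, -, rfl⟩ := Finset.mem_image.1 hv
        rw [← hI.2.1, ← hI.2.2, ← Finset.image_union]
        refine Finset.mem_image_of_mem _ ?_
        simp [lt_or_ge]
      · rw [Finset.card_image_of_injective _ hI.1, hc, Finset.card_univ, Fintype.card_fin]
    rw [himg, ← Finset.image_erase hI.1, Finset.prod_image fun a _ b _ h => hI.1 h]
  simp only [ite_mul, zero_mul]
  rw [← Finset.sum_filter, Finset.filter_filter]
  split_ifs with hi
  · have : ∀ I ∈ Finset.univ.filter (fun I : Fin m → V => I 0 = i ∧ ListsEdge I e),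
        1 / (((m - e.1.card).factorial : ℝ) * ((e.1.card - 1).factorial : ℝ)) *
          ∏ j ∈ Finset.univ.erase (0 : Fin m), w (I j) =
        1 / (((m - e.1.card).factorial : ℝ) * ((e.1.card - 1).factorial : ℝ)) *
          ∏ v ∈ (e.1 ∪ e.2).erase i, w v := by
      intro I hI
      obtain ⟨-, h0, hI⟩ := Finset.mem_filter.1 hI
      rw [hprod I hI, h0]
    rw [Finset.sum_congr rfl this, Finset.sum_const, nsmul_eq_mul]
    simp only [and_comm (a := _ = i)]
    -- The number of listings starting at `i` is the denominator of the entry, so the edge counts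
    -- once.
    rw [card_listsEdge hd hc hi]
    push_cast
    field_simp
  · refine Finset.sum_eq_zero fun I hI => ?_
    obtain ⟨-, h0, hI⟩ := Finset.mem_filter.1 hI
    exact absurd (h0 ▸ hlists I hI) hi

/-- The action of the out-adjacency hypermatrix on the vector that is `t` at `a` and `1` elsewhere. -/
theorem realApply_outAdjacency_ite {m : ℕ} [NeZero m] (hH : H.IsUniform m) (a : V) (t : ℝ) (i : V) :
    (H.outAdjacency m).realApply (fun v => if v = a then t else 1) i =
      ∑ e ∈ H.edges with i ∈ e.1, if a ∈ (e.1 ∪ e.2).erase i then t else 1 := by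
  rw [H.realApply_outAdjacency hH]
  exact Finset.sum_congr rfl fun e _ => Finset.prod_ite_eq' _ _ _

/-- The factor of the root is omitted from each product, so `t` never occurs at `a`. -/
theorem realApply_outAdjacency_self {m : ℕ} [NeZero m] (hH : H.IsUniform m) (a : V) (t : ℝ) :
    (H.outAdjacency m).realApply (fun v => if v = a then t else 1) a = H.outDegree a := by
  rw [H.realApply_outAdjacency_ite hH]
  simp [outDegree]

theorem le_realApply_outAdjacency {m : ℕ} [NeZero m] (hH : H.IsUniform m) (a : V) {t : ℝ}
    (ht : t ≤ 1) (i : V) : H.outDegree i * t ≤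
    (H.outAdjacency m).realApply (fun v => if v = a then t else 1) i := by
  rw [H.realApply_outAdjacency_ite hH, outDegree, ← nsmul_eq_mul]
  refine Finset.card_nsmul_le_sum _ _ _ fun e _ => ?_
  split_ifs
  exacts [le_rfl, ht]

theorem realApply_outAdjacency_le {m : ℕ} [NeZero m] (hH : H.IsUniform m) (a : V) {t : ℝ}
    (ht : 1 ≤ t) (i : V) : (H.outAdjacency m).realApply (fun v => if v = a then t else 1) i ≤
    H.outDegree i * t := by
  rw [H.realApply_outAdjacency_ite hH, outDegree, ← nsmul_eq_mul]
  refine Finset.sum_le_card_nsmul _ _ _ fun e _ => ?_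
  split_ifs
  exacts [le_rfl, ht]

/-! ### Degree bounds from the test vectors -/

/-- The weight that balances the bounds at the exceptional vertex and at the others. -/
theorem exists_balancing_weight {m : ℕ} (hm : 2 ≤ m) {d D : ℝ} (hd : 0 < d) (hD : 0 < D) :
    ∃ t : ℝ, 0 < t ∧ (d ≤ D → t ≤ 1) ∧ (D ≤ d → 1 ≤ t) ∧
      d ^ (1 / (m : ℝ)) * D ^ (1 - 1 / (m : ℝ)) = D * t ∧
      d ^ (1 / (m : ℝ)) * D ^ (1 - 1 / (m : ℝ)) * t ^ (m - 1) = d := by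
  have hq : 0 < d / D := div_pos hd hD
  have heq : d ^ (1 / (m : ℝ)) * D ^ (1 - 1 / (m : ℝ)) = D * (d / D) ^ (1 / (m : ℝ)) := by
    rw [Real.div_rpow hd.le hD.le, Real.rpow_sub hD, Real.rpow_one]
    ring
  -- Dividing `ρ t^(m-1) = d` by `ρ = D t` gives `t^m = d / D`.
  refine ⟨(d / D) ^ (1 / (m : ℝ)), Real.rpow_pos_of_pos hq _, fun h => ?_, fun h => ?_, heq, ?_⟩
  · exact Real.rpow_le_one hq.le ((div_le_one hD).2 h) (by positivity)
  · exact Real.one_le_rpow ((one_le_div hD).2 h) (by positivity)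
  · rw [heq, mul_assoc, ← pow_succ', Nat.sub_add_cancel (by omega), one_div,
      Real.rpow_inv_natCast_pow hq.le (by omega), mul_div_cancel₀ _ hD.ne']

/-- There are no edges, and `x i ^ 0 = 1` turns the eigenvalue equation into `0 = l`. The Perron
argument does not cover this case, since its degree `m - 1` is zero. -/
theorem isGreatest_eigenvalueModuli_of_uniform_one [Nonempty V] (hH : H.IsUniform 1) :
    IsGreatest (H.outAdjacency 1).eigenvalueModuli 0 := by
  have h0 : ∀ x i, (H.outAdjacency 1).apply x i = 0 := fun x i => by
    simp [Hypermatrix.apply, outAdjacency, uniform_one_edges hH]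
  refine ⟨⟨0, ⟨1, one_ne_zero, fun i => by simp [h0]⟩, by simp⟩, ?_⟩
  rintro _ ⟨l, ⟨x, -, hx⟩, rfl⟩
  have := hx (Classical.arbitrary V)
  rw [h0] at this
  simp at this
  simp [← this]

theorem le_spectralRadius_outAdjacency {m : ℕ} [NeZero m] (hm : 2 ≤ m) (hH : H.IsUniform m)
    {r : ℝ} (a : V) (D : ℕ) (ha : H.outDegree a ≤ D) (hD : ∀ v, v ≠ a → D ≤ H.outDegree v)
    (hr : 0 ≤ r)
    (hopt : ∀ y : V → ℝ, 0 ≤ y → y ≠ 0 → ∀ μ : ℝ,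
      (∀ i, μ * y i ^ (m - 1) ≤ (H.outAdjacency m).realApply y i) → μ ≤ r) :
    (H.outDegree a : ℝ) ^ (1 / (m : ℝ)) * (D : ℝ) ^ (1 - 1 / (m : ℝ)) ≤ r := by
  rcases Nat.eq_zero_or_pos (H.outDegree a) with h0 | hpos
  · rw [h0, Nat.cast_zero, Real.zero_rpow, zero_mul]
    · exact hr
    · have : (0 : ℝ) < m := by exact_mod_cast (by omega : 0 < m)
      positivity
  obtain ⟨t, ht, ht1, -, e1, e2⟩ := exists_balancing_weight hm
    (d := (H.outDegree a : ℝ)) (D := (D : ℝ)) (by exact_mod_cast hpos)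
    (by exact_mod_cast hpos.trans_le ha)
  have ht1 := ht1 (by exact_mod_cast ha)
  refine hopt (fun v => if v = a then t else 1) (fun v => ?_) (fun h => ?_) _ fun i => ?_
  · dsimp only
    split_ifs
    exacts [ht.le, zero_le_one]
  · have := congrFun h a
    simp [ht.ne'] at this
  · by_cases hi : i = a
    · subst hi
      rw [H.realApply_outAdjacency_self hH, if_pos rfl, e2]
    · rw [if_neg hi, one_pow, mul_one, e1]
      refine le_trans ?_ (H.le_realApply_outAdjacency hH a ht1 i)
      gcongr
      exact hD i hi

theorem spectralRadius_outAdjacency_le {m : ℕ} [NeZero m] (hm : 2 ≤ m) (hH : H.IsUniform m)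
    {r : ℝ} (a : V) (D : ℕ) (ha : D ≤ H.outDegree a) (hD : ∀ v, v ≠ a → H.outDegree v ≤ D)
    (hopt : ∀ w : V → ℝ, (∀ i, 0 < w i) → ∀ μ : ℝ,
      (∀ i, (H.outAdjacency m).realApply w i ≤ μ * w i ^ (m - 1)) → r ≤ μ) :
    r ≤ (H.outDegree a : ℝ) ^ (1 / (m : ℝ)) * (D : ℝ) ^ (1 - 1 / (m : ℝ)) := by
  have hw : ∀ t : ℝ, 0 < t → ∀ i : V, 0 < (if i = a then t else 1) := fun t ht i => by
    split_ifs
    exacts [ht, zero_lt_one]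
  rcases Nat.eq_zero_or_pos D with h0 | hpos
  -- No balancing weight exists when `D = 0`. The rows other than `a` vanish, so a large `t` makes
  -- every `μ > 0` an upper bound: `t ≥ 1` and `t ≥ d / μ` give `d ≤ μ t^(m-1)`.
  · subst h0
    have hm' : (1 : ℝ) < m := by exact_mod_cast (by omega : 1 < m)
    have hexp : 1 - 1 / (m : ℝ) ≠ 0 := by
      have : 1 / (m : ℝ) < 1 := (div_lt_one (by linarith)).2 hm'
      linarith
    rw [Nat.cast_zero, Real.zero_rpow hexp, mul_zero]
    refine le_of_forall_pos_le_add fun μ hμ => ?_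
    rw [zero_add]
    set t : ℝ := max 1 (H.outDegree a / μ) with htdef
    have ht1 : 1 ≤ t := le_max_left _ _
    refine hopt _ (hw t (by linarith)) μ fun i => ?_
    by_cases hi : i = a
    · subst hi
      rw [H.realApply_outAdjacency_self hH, if_pos rfl, mul_comm, ← div_le_iff₀ hμ]
      exact (le_max_right _ _).trans (le_self_pow₀ ht1 (by omega))
    · refine (H.realApply_outAdjacency_le hH a ht1 i).trans ?_
      rw [Nat.le_zero.1 (hD i hi), if_neg hi]
      simpa using hμ.le
  · obtain ⟨t, ht, -, ht1, e1, e2⟩ := exists_balancing_weight hm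
      (d := (H.outDegree a : ℝ)) (D := (D : ℝ)) (by exact_mod_cast hpos.trans_le ha)
      (by exact_mod_cast hpos)
    have ht1 := ht1 (by exact_mod_cast ha)
    refine hopt _ (hw t ht) _ fun i => ?_
    by_cases hi : i = a
    · subst hi
      rw [H.realApply_outAdjacency_self hH, if_pos rfl, e2]
    · rw [if_neg hi, one_pow, mul_one, e1]
      refine (H.realApply_outAdjacency_le hH a ht1 i).trans ?_
      gcongr
      exact hD i hi

end DirectedHypergraph

/-! ### The two bounds for the spectral radius -/

theorem mainTheorem2 {V : Type*} [Fintype V] [DecidableEq V] (H : DirectedHypergraph V)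
    (m : ℕ) [NeZero m] (hH : H.IsUniform m)
    (n : ℕ) (hn : 2 ≤ n) (v : Fin n ≃ V) (hd : Monotone fun i => H.outDegree (v i)) :
    IsGreatest (H.outAdjacency m).eigenvalueModuli (H.outAdjacency m).spectralRadius ∧
    (H.minOutDegree : ℝ) ^ (1 / (m : ℝ)) *
        (H.outDegree (v ⟨1, by omega⟩) : ℝ) ^ (1 - 1 / (m : ℝ)) ≤
      (H.outAdjacency m).spectralRadius ∧
    (H.outAdjacency m).spectralRadius ≤
      (H.maxOutDegree : ℝ) ^ (1 / (m : ℝ)) *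
        (H.outDegree (v ⟨n - 2, by omega⟩) : ℝ) ^ (1 - 1 / (m : ℝ)) := by
  have : Nonempty V := ⟨v ⟨0, by omega⟩⟩
  have hmin : H.minOutDegree = H.outDegree (v ⟨0, by omega⟩) := by
    refine IsLeast.csInf_eq (s := Set.range H.outDegree) ⟨⟨_, rfl⟩, ?_⟩
    rintro _ ⟨u, rfl⟩
    have := hd (show (⟨0, by omega⟩ : Fin n) ≤ v.symm u from Nat.zero_le _)
    simpa using this
  have hmax : H.maxOutDegree = H.outDegree (v ⟨n - 1, by omega⟩) := by
    refine IsGreatest.csSup_eq (s := Set.range H.outDegree) ⟨⟨_, rfl⟩, ?_⟩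
    rintro _ ⟨u, rfl⟩
    have := hd (show v.symm u ≤ (⟨n - 1, by omega⟩ : Fin n) from
      Nat.le_sub_one_of_lt (v.symm u).2)
    simpa using this
  have hm0 : m ≠ 0 := NeZero.ne m
  rcases (by omega : m = 1 ∨ 2 ≤ m) with rfl | hm
  · have hG := H.isGreatest_eigenvalueModuli_of_uniform_one hH
    have hdeg : ∀ u, H.outDegree u = 0 := fun u => by
      simp [DirectedHypergraph.outDegree, DirectedHypergraph.uniform_one_edges hH]
    have hρ : (H.outAdjacency 1).spectralRadius = 0 := hG.csSup_eq
    rw [hρ, hmin, hmax]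
    exact ⟨hG, by simp [hdeg], by simp [hdeg]⟩
  · obtain ⟨r, hG, ⟨x, hx, hx0, hrx⟩, hopt⟩ :=
      Hypermatrix.exists_perron hm (H.outAdjacency_nonneg m)
    have hρ : (H.outAdjacency m).spectralRadius = r := hG.csSup_eq
    have hr : 0 ≤ r := by
      obtain ⟨l, -, h⟩ := hG.1
      exact h ▸ norm_nonneg l
    rw [hρ, hmin, hmax]
    -- The exceptional vertex is the first of the enumeration for the lower bound and the last for
    -- the upper one. Indices start at `0`, so `d_2` and `d_{n-1}` sit at `1` and `n - 2`.
    refine ⟨hG, H.le_spectralRadius_outAdjacency hm hH _ _ (hd ?_) (fun u hu => ?_) hr hopt,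
      H.spectralRadius_outAdjacency_le hm hH _ _ (hd ?_) (fun u hu => ?_) fun w hw μ hμ =>
        Hypermatrix.eigenvalue_le_of_realApply_le (H.outAdjacency_nonneg m) hx hx0 hw hrx hμ⟩
    · exact Nat.zero_le _
    · have hne : v.symm u ≠ ⟨0, by omega⟩ := fun h => hu (by rw [← h, v.apply_symm_apply])
      have hle : (⟨1, by omega⟩ : Fin n) ≤ v.symm u := by
        rw [Fin.le_def]
        rw [Ne, Fin.ext_iff] at hne
        simp only at hne ⊢
        omega
      simpa using hd hle
    · rw [Fin.le_def]
      simp only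
      omega
    · have hne : v.symm u ≠ ⟨n - 1, by omega⟩ := fun h => hu (by rw [← h, v.apply_symm_apply])
      have hle : v.symm u ≤ (⟨n - 2, by omega⟩ : Fin n) := by
        rw [Fin.le_def]
        rw [Ne, Fin.ext_iff] at hne
        have := (v.symm u).2
        simp only at hne ⊢
        omega
      simpa using hd hle
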